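/- **Definitions.** A *Schröder tree* is a plane rooted tree in which every internal vertex has at least two children. A *Schröder pseudocomposition* is the Polish code of a Schröder tree having at least one internal vertex: one reads the vertices in prefix order, writing $0$ for a leaf and $i$ for an internal vertex with $i+1$ children. Put $x=100$. For pseudocompositions $I,J$ write $J=J'0^m$ where $J'$ does not end by $0$, and set $$I\prec J=J'\cdot 0^{m-1}\cdot I,\qquad I\circ J=(J'\triangleright I)\cdot 0^{m-1},\qquad I\succ J=J'\cdot I\cdot 0^{m-1},$$ where $\cdot$ is concatenation and $u\triangleright v$ is obtained from $u\cdot v$ by replacing the last entry of $u$ and the first entry of $v$ by their sum. A *parking quasi-ribbon* is a nonempty nondecreasing word $a_1\cdots a_n$ of positive integers with $a_i\le i$ for all $i$, in which bars may be inserted between consecutive letters that are different. For parking quasi-ribbons, with $\beta[k]$ denoting $\beta$ with all letters shifted by $k$ and $|\alpha|$ the number of letters of $\alpha$, set $$\alpha\prec\beta=\alpha\cdot\beta[\max(\alpha)-1],\qquad \alpha\circ\beta=\alpha|\beta[|\alpha|],\qquad \alpha\succ\beta=\alpha\cdot\beta[|\alpha|].$$ The map $\phi$ from Schröder trees to words with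 bars is defined as follows. A leaf is sent to the empty word, and $\max(\emptyset)=1$. If the root of $T$ has exactly two subtrees $T_1,T_2$ (in this order), then $$\phi(T)=\phi(T_2)\cdot\phi(T_1)[\max(\phi(T_2))-1]\cdot\bigl(|\phi(T_1)|+\max(\phi(T_2))\bigr).$$ If it has subtrees $T_1,\dots,T_r$ with $r\ge3$, let $S$ be the tree whose root has subtrees $T_1,\dots,T_{r-1}$; then $\phi(T)$ is given by the same formula with $(T_1,T_2)$ replaced by $(S,T_r)$, with in addition a bar inserted before the last letter. The seven *triduplicial relations* for three binary operations are $$(x\prec y)\prec z=x\prec(y\prec z),\quad (x\circ y)\circ z=x\circ(y\circ z),\quad (x\succ y)\succ z=x\succ(y\succ z),$$ $$(x\succ y)\prec z=x\succ(y\prec z),\quad (x\circ y)\prec z=x\circ(y\prec z),\quad (x\succ y)\circ z=x\succ(y\circ z),\quad (x\circ y)\succ z=x\circ(y\succ z).$$ A *triduplicial algebra* over a commutative ring $K$ is a $K$-module with three bilinear operations satisfying these relations. **Theorem.** The three operations are well defined on the set of Schröder pseudocompositions, and: 1. Sending the Polish code of a Schröder tree $T$ (with at least one internal vertex) to $\phi(T)$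 is a well-defined bijection from Schröder pseudocompositions onto parking quasi-ribbons; it maps $x=100$ to $1$ and carries the operations $\prec,\circ,\succ$ on pseudocompositions to the operations $\prec,\circ,\succ$ on parking quasi-ribbons. 2. The operations $\prec,\circ,\succ$ on Schröder pseudocompositions satisfy the seven triduplicial relations. 3. The resulting structure is freely generated by $x=100$: for every set $S$ with three binary operations satisfying the triduplicial relations and every $a\in S$, there is a unique map $f$ from the set of Schröder pseudocompositions to $S$ which preserves the three operations and satisfies $f(x)=a$. Likewise, for every commutative ring $K$, the free $K$-module on the set of Schröder pseudocompositions, with the operations extended bilinearly, is the free triduplicial algebra over $K$ on the generator $x$: for every triduplicial $K$-algebra $B$ and every $b\in B$ there is a unique morphism of triduplicial algebras from it to $B$ sending $x$ to $b$. -/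

import Mathlib

universe u v w

namespace Schroder

/-! ### Schröder trees and their Polish codes -/

/-- Schröder trees (reduced plane trees): every internal vertex has at least two children.
`node n c` is the tree whose root has the `n + 2` ordered subtrees `c 0, …, c (n + 1)`. -/
inductive SchroderTree : Type
  | leaf : SchroderTree
  | node (n : ℕ) (c : Fin (n + 2) → SchroderTree) : SchroderTree

/-- The Polish code: the vertices are read in prefix order, a leaf is written `0`, and an
internal vertex with `i + 1` children is written `i`. -/
def SchroderTree.code : SchroderTree → List ℕ
  | .leaf => [0]
  | .node n c => (n + 1) :: (List.ofFn fun i => (c i).code).flatten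

/-- A Schröder pseudocomposition: the Polish code of a Schröder tree with at least one
internal vertex. -/
def IsPseudocomposition (I : List ℕ) : Prop :=
  ∃ (n : ℕ) (c : Fin (n + 2) → SchroderTree), (SchroderTree.node n c).code = I

/-- The set of Schröder pseudocompositions. -/
abbrev Pseudocomposition : Type := {I : List ℕ // IsPseudocomposition I}

/-- The pseudocomposition encoding the tree `node n c`. -/
def Pseudocomposition.ofNode (n : ℕ) (c : Fin (n + 2) → SchroderTree) : Pseudocomposition :=
  ⟨(SchroderTree.node n c).code, n, c, rfl⟩

/-! ### The three operations on exponent vectors -/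

/-- For `J = J'0^m` with `J'` not ending by a `0`, this is `J'`. -/
def stem (J : List ℕ) : List ℕ := J.rdropWhile (fun i => i == 0)

/-- For `J = J'0^m` with `J'` not ending by a `0`, this is `m`. -/
def zeros (J : List ℕ) : ℕ := (J.rtakeWhile (fun i => i == 0)).length

/-- `u ▷ v`: the last entry of `u` and the first entry of `v` are added together
(for nonempty `u` and `v`). -/
def nearConcat : List ℕ → List ℕ → List ℕ
  | [], v => v
  | [a], [] => [a]
  | [a], b :: v => (a + b) :: v
  | a :: a' :: u, v => a :: nearConcat (a' :: u) v

/-- `I ≺ J = J' · 0^(m-1) · I`. -/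
def codePrec (I J : List ℕ) : List ℕ := stem J ++ List.replicate (zeros J - 1) 0 ++ I

/-- `I ∘ J = (J' ▷ I) · 0^(m-1)`. -/
def codeCirc (I J : List ℕ) : List ℕ := nearConcat (stem J) I ++ List.replicate (zeros J - 1) 0

/-- `I ≻ J = J' · I · 0^(m-1)`. -/
def codeSucc (I J : List ℕ) : List ℕ := stem J ++ I ++ List.replicate (zeros J - 1) 0

/-! Stability of the set of Schröder pseudocompositions under the three operations. -/

theorem code_ends (T : SchroderTree) : ∃ w, T.code = w ++ [0] := by
  induction T with
  | leaf => exact ⟨[], rfl⟩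
  | node n c ih =>
    obtain ⟨w, hw⟩ := ih (Fin.last (n + 1))
    refine ⟨(n + 1) :: (List.ofFn fun i : Fin (n + 1) => (c i.castSucc).code).flatten ++ w, ?_⟩
    simp only [SchroderTree.code]
    rw [List.ofFn_succ_last]
    simp [hw]

/-- In a forest, a leaf may be replaced by an arbitrary tree. -/
theorem forest_subst (U : SchroderTree) (n : ℕ) (c : Fin n → SchroderTree)
    (hc : ∀ i a b, (c i).code = a ++ 0 :: b → ∃ V : SchroderTree, V.code = a ++ U.code ++ b)
    (a b : List ℕ) (h : (List.ofFn fun i => (c i).code).flatten = a ++ 0 :: b) :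
    ∃ c' : Fin n → SchroderTree,
      (List.ofFn fun i => (c' i).code).flatten = a ++ U.code ++ b := by
  induction n generalizing a with
  | zero => simp at h
  | succ n ih =>
    rw [List.ofFn_succ, List.flatten_cons, List.append_eq_append_iff] at h
    rcases h with ⟨a', rfl, h⟩ | ⟨b', h, h'⟩
    · obtain ⟨c', hc'⟩ := ih (fun i => c i.succ) (fun i => hc i.succ) a' h
      exact ⟨Fin.cons (c 0) c', by simp [List.ofFn_succ, hc']⟩
    · cases b' with
      | nil =>
        obtain ⟨c', hc'⟩ := ih (fun i => c i.succ) (fun i => hc i.succ) [] (by simpa using h'.symm)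
        refine ⟨Fin.cons (c 0) c', ?_⟩
        simp only [List.append_nil] at h
        simp [List.ofFn_succ, hc', h]
      | cons z b' =>
        simp only [List.cons_append, List.cons.injEq] at h'
        obtain ⟨rfl, rfl⟩ := h'
        obtain ⟨V, hV⟩ := hc 0 a b' h
        exact ⟨Fin.cons V (fun i => c i.succ), by simp [List.ofFn_succ, hV]⟩

theorem tree_subst (T U : SchroderTree) (a b : List ℕ) (h : T.code = a ++ 0 :: b) :
    ∃ V : SchroderTree, V.code = a ++ U.code ++ b := by
  induction T generalizing a b with
  | leaf =>
    cases a with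
    | nil => simp only [SchroderTree.code, List.nil_append, List.cons.injEq, true_and] at h
             exact ⟨U, by simp [← h]⟩
    | cons x a => simp [SchroderTree.code] at h
  | node n c ih =>
    cases a with
    | nil => simp [SchroderTree.code] at h
    | cons x a =>
      simp only [SchroderTree.code, List.cons_append, List.cons.injEq] at h
      obtain ⟨c', hc'⟩ := forest_subst U (n + 2) c ih a b h.2
      exact ⟨.node n c', by rw [SchroderTree.code, hc', h.1]; simp⟩

/-- In a forest, the root of a tree may be merged with an internal vertex whose first child is
a leaf, the children of the merged root taking the place of this leaf. -/
theorem forest_merge (p : ℕ) (r : List ℕ) (n : ℕ) (c : Fin n → SchroderTree)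
    (hc : ∀ i a k b, (c i).code = a ++ (k + 1) :: 0 :: b →
      ∃ V : SchroderTree, V.code = a ++ (k + 1 + (p + 1)) :: (r ++ b))
    (a : List ℕ) (k : ℕ) (b : List ℕ)
    (h : (List.ofFn fun i => (c i).code).flatten = a ++ (k + 1) :: 0 :: b) :
    ∃ c' : Fin n → SchroderTree,
      (List.ofFn fun i => (c' i).code).flatten = a ++ (k + 1 + (p + 1)) :: (r ++ b) := by
  induction n generalizing a with
  | zero => simp at h
  | succ n ih =>
    rw [List.ofFn_succ, List.flatten_cons, List.append_eq_append_iff] at h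
    rcases h with ⟨a', rfl, h⟩ | ⟨b', h, h'⟩
    · obtain ⟨c', hc'⟩ := ih (fun i => c i.succ) (fun i => hc i.succ) a' h
      exact ⟨Fin.cons (c 0) c', by simp [List.ofFn_succ, hc']⟩
    · rcases b' with _ | ⟨z, _ | ⟨y, b'⟩⟩
      · obtain ⟨c', hc'⟩ := ih (fun i => c i.succ) (fun i => hc i.succ) [] (by simpa using h'.symm)
        refine ⟨Fin.cons (c 0) c', ?_⟩
        simp only [List.append_nil] at h
        simp [List.ofFn_succ, hc', h]
      · simp only [List.cons_append, List.cons.injEq] at h'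
        obtain ⟨w, hw⟩ := code_ends (c 0)
        rw [hw] at h
        have := (List.append_inj' h rfl).2
        simp [← h'.1] at this
      · simp only [List.cons_append, List.cons.injEq] at h'
        obtain ⟨rfl, rfl, rfl⟩ := h'
        obtain ⟨V, hV⟩ := hc 0 a k b' h
        exact ⟨Fin.cons V (fun i => c i.succ), by simp [List.ofFn_succ, hV]⟩

theorem tree_merge (p : ℕ) (d : Fin (p + 2) → SchroderTree) (T : SchroderTree)
    (a : List ℕ) (k : ℕ) (b : List ℕ) (h : T.code = a ++ (k + 1) :: 0 :: b) :
    ∃ V : SchroderTree, V.code =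
      a ++ (k + 1 + (p + 1)) :: ((List.ofFn fun i => (d i).code).flatten ++ b) := by
  induction T generalizing a k b with
  | leaf => rcases a with _ | ⟨x, a⟩ <;> simp [SchroderTree.code] at h
  | node n c ih =>
    cases a with
    | nil =>
      simp only [SchroderTree.code, List.nil_append, List.cons.injEq, Nat.add_right_cancel_iff] at h
      obtain ⟨rfl, h⟩ := h
      rw [List.ofFn_succ, List.flatten_cons] at h
      have hb : (List.ofFn fun i : Fin (n + 1) => (c i.succ).code).flatten = b := by
        cases h0 : c 0 with
        | leaf => simpa [h0, SchroderTree.code] using h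
        | node m e => simp [h0, SchroderTree.code] at h
      refine ⟨.node (n + 1 + p) (fun i => Fin.append d (fun i : Fin (n + 1) => c i.succ)
        (i.cast (by omega))), ?_⟩
      have key : (List.ofFn fun i : Fin (n + 1 + p + 2) =>
          (Fin.append d (fun i : Fin (n + 1) => c i.succ) (i.cast (by omega))).code) =
          (List.ofFn fun i => (d i).code) ++ List.ofFn fun i : Fin (n + 1) => (c i.succ).code := by
        rw [← List.ofFn_fin_append, List.ofFn_congr (show n + 1 + p + 2 = p + 2 + (n + 1) by omega)]
        congr 1
        funext i
        refine Fin.addCases (fun j => ?_) (fun j => ?_) i <;> simp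
      rw [SchroderTree.code, key, List.flatten_append, hb]
      simp only [List.nil_append, List.cons.injEq, and_true]
      omega
    | cons x a =>
      simp only [SchroderTree.code, List.cons_append, List.cons.injEq] at h
      obtain ⟨c', hc'⟩ := forest_merge p _ (n + 2) c ih a k b h.2
      exact ⟨.node n c', by rw [SchroderTree.code, hc', h.1]; simp⟩

theorem stem_append_zeros (J : List ℕ) : J = stem J ++ List.replicate (zeros J) 0 := by
  have h : J.rtakeWhile (fun i => i == 0) = List.replicate (zeros J) 0 :=
    List.eq_replicate_iff.2 ⟨rfl, fun b hb => by simpa using List.mem_rtakeWhile_imp hb⟩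
  rw [← h]
  exact List.rdropWhile_append_rtakeWhile.symm

/-- A pseudocomposition has the shape `J'0^m` with `m ≥ 1` and `J'` ending by a positive entry. -/
theorem pseudocomposition_shape {J : List ℕ} (hJ : IsPseudocomposition J) :
    (∃ a k, stem J = a ++ [k + 1]) ∧ ∃ m, zeros J = m + 1 := by
  obtain ⟨n, c, rfl⟩ := hJ
  set J := (SchroderTree.node n c).code with hJ
  constructor
  · have hne : stem J ≠ [] := by
      intro h
      have := (List.rdropWhile_eq_nil_iff.1 h) (n + 1) (by simp [hJ, SchroderTree.code])
      simp at this
    have hl := List.rdropWhile_last_not (fun i => i == 0) J hne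
    obtain ⟨k, hk⟩ := Nat.exists_eq_succ_of_ne_zero (n := (stem J).getLast hne)
      (by simpa [stem] using hl)
    exact ⟨_, k, by rw [← Nat.succ_eq_add_one, ← hk]; exact (List.dropLast_append_getLast hne).symm⟩
  · obtain ⟨w, hw⟩ := code_ends (SchroderTree.node n c)
    refine Nat.exists_eq_succ_of_ne_zero ?_
    rw [zeros, hJ, hw]
    simp

theorem isPseudocomposition_of_code {T : SchroderTree} {I : List ℕ} (h : T.code = I)
    (hI : 2 ≤ I.length) : IsPseudocomposition I := by
  cases T with
  | leaf => simp [← h, SchroderTree.code] at hI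
  | node n c => exact ⟨n, c, h⟩

theorem IsPseudocomposition.prec {I J : List ℕ} (hI : IsPseudocomposition I)
    (hJ : IsPseudocomposition J) : IsPseudocomposition (codePrec I J) := by
  obtain ⟨⟨a, k, ha⟩, m, hm⟩ := pseudocomposition_shape hJ
  have hs := stem_append_zeros J
  obtain ⟨n, c, hT⟩ := hJ
  obtain ⟨p, d, hU⟩ := hI
  obtain ⟨V, hV⟩ := tree_subst (.node n c) (.node p d) (stem J ++ List.replicate m 0) []
    (by rw [hT, List.append_assoc, ← List.replicate_succ', ← hm]; exact hs)
  refine isPseudocomposition_of_code (T := V) (by rw [hV, hU]; simp [codePrec, hm]) ?_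
  rw [codePrec, ← hU]
  simp [ha, SchroderTree.code]
  omega

theorem IsPseudocomposition.succ {I J : List ℕ} (hI : IsPseudocomposition I)
    (hJ : IsPseudocomposition J) : IsPseudocomposition (codeSucc I J) := by
  obtain ⟨⟨a, k, ha⟩, m, hm⟩ := pseudocomposition_shape hJ
  have hs := stem_append_zeros J
  obtain ⟨n, c, hT⟩ := hJ
  obtain ⟨p, d, hU⟩ := hI
  obtain ⟨V, hV⟩ := tree_subst (.node n c) (.node p d) (stem J) (List.replicate m 0)
    (by rw [hT, ← List.replicate_succ, ← hm]; exact hs)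
  refine isPseudocomposition_of_code (T := V) (by rw [hV, hU]; simp [codeSucc, hm]) ?_
  rw [codeSucc, ← hU]
  simp [ha, SchroderTree.code]
  omega

theorem nearConcat_concat_cons (a : List ℕ) (k b : ℕ) (v : List ℕ) :
    nearConcat (a ++ [k]) (b :: v) = a ++ (k + b) :: v := by
  induction a with
  | nil => rfl
  | cons x a ih => cases a <;> simp_all [nearConcat]

theorem IsPseudocomposition.circ {I J : List ℕ} (hI : IsPseudocomposition I)
    (hJ : IsPseudocomposition J) : IsPseudocomposition (codeCirc I J) := by
  obtain ⟨⟨a, k, ha⟩, m, hm⟩ := pseudocomposition_shape hJ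
  have hs := stem_append_zeros J
  obtain ⟨n, c, hT⟩ := hJ
  obtain ⟨p, d, rfl⟩ := hI
  obtain ⟨V, hV⟩ := tree_merge p d (.node n c) a k (List.replicate m 0)
    (by rw [hT, ← List.replicate_succ, ← hm]; rw [ha] at hs; simpa using hs)
  have e : codeCirc (SchroderTree.node p d).code J =
      a ++ (k + 1 + (p + 1)) :: ((List.ofFn fun i => (d i).code).flatten ++ List.replicate m 0) := by
    simp [codeCirc, ha, hm, SchroderTree.code, nearConcat_concat_cons]
  refine isPseudocomposition_of_code (T := V) (hV.trans e.symm) ?_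
  obtain ⟨w, hw⟩ := code_ends (d 0)
  rw [e, List.ofFn_succ, hw]
  simp
  omega

/-- `I ≺ J = J' · 0^(m-1) · I`. -/
def Pseudocomposition.prec (I J : Pseudocomposition) : Pseudocomposition :=
  ⟨codePrec I.1 J.1, I.2.prec J.2⟩

/-- `I ∘ J = (J' ▷ I) · 0^(m-1)`. -/
def Pseudocomposition.circ (I J : Pseudocomposition) : Pseudocomposition :=
  ⟨codeCirc I.1 J.1, I.2.circ J.2⟩

/-- `I ≻ J = J' · I · 0^(m-1)`. -/
def Pseudocomposition.succ (I J : Pseudocomposition) : Pseudocomposition :=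
  ⟨codeSucc I.1 J.1, I.2.succ J.2⟩

/-- The first operation is also near-concatenation: `I ≺ J = J ▷ I`. -/
theorem codePrec_eq_nearConcat {I J : List ℕ} (hI : IsPseudocomposition I)
    (hJ : IsPseudocomposition J) : codePrec I J = nearConcat J I := by
  obtain ⟨-, m, hm⟩ := pseudocomposition_shape hJ
  obtain ⟨n, c, rfl⟩ := hI
  have hs := stem_append_zeros J
  rw [hm, List.replicate_succ', ← List.append_assoc] at hs
  conv_rhs => rw [hs]
  rw [SchroderTree.code, nearConcat_concat_cons]
  simp [codePrec, hm]

/-- The pseudocomposition `x = 100`. -/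
def Pseudocomposition.x : Pseudocomposition :=
  ⟨[1, 0, 0], 0, fun _ => .leaf, rfl⟩

/-! ### Parking quasi-ribbons -/

/-- A segmented word: the letter `(a, false)` is the integer `a`, the letter `(a, true)` is the
integer `a` preceded by a bar. For instance `11|3` is `[(1, false), (1, false), (3, true)]`. -/
abbrev SegWord : Type := List (ℕ × Bool)

/-- A parking quasi-ribbon: a nonempty nondecreasing parking function, with bars allowed between
different (consecutive) values. -/
structure IsParkingQuasiRibbon (α : SegWord) : Prop where
  ne_nil : α ≠ []
  pos : ∀ l ∈ α, 1 ≤ l.1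
  /-- consecutive letters are nondecreasing, and are different if there is a bar between them -/
  chain : α.IsChain (fun l l' => l.1 ≤ l'.1 ∧ (l'.2 = true → l.1 ≠ l'.1))
  /-- the parking condition `a_i ≤ i` (positions are counted from `0` here) -/
  parking : ∀ (i : ℕ) (hi : i < α.length), (α[i]).1 ≤ i + 1
  /-- there is no bar before the first letter -/
  head_no_bar : ∀ l ∈ α.head?, l.2 = false

/-- The set of parking quasi-ribbons. -/
abbrev ParkingQuasiRibbon : Type := {α : SegWord // IsParkingQuasiRibbon α}

/-- `max(α)`, with the convention that the maximum of the empty word is `1`. -/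
def maxLetter (α : SegWord) : ℕ := (α.map Prod.fst).foldr max 1

/-- `α[k]`: every letter is shifted by `k`, the bars being kept. -/
def shift (α : SegWord) (k : ℕ) : SegWord := α.map fun l => (l.1 + k, l.2)

/-- `|α`: a bar is put before the first letter. -/
def barHead : SegWord → SegWord
  | [] => []
  | l :: α => (l.1, true) :: α

/-- `α ≺ β = α · β[max(α) - 1]`. -/
def wordPrec (α β : SegWord) : SegWord := α ++ shift β (maxLetter α - 1)

/-- `α ∘ β = α | β[|α|]`. -/
def wordCirc (α β : SegWord) : SegWord := α ++ barHead (shift β α.length)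

/-- `α ≻ β = α · β[|α|]`. -/
def wordSucc (α β : SegWord) : SegWord := α ++ shift β α.length

/-! Stability of the set of parking quasi-ribbons under the three operations. -/

theorem one_le_maxLetter (α : SegWord) : 1 ≤ maxLetter α := by
  induction α with
  | nil => simp [maxLetter]
  | cons l α ih => simp only [maxLetter, List.map_cons, List.foldr_cons] at *; omega

theorem le_maxLetter {α : SegWord} {l : ℕ × Bool} (h : l ∈ α) : l.1 ≤ maxLetter α := by
  induction α with
  | nil => simp at h
  | cons l' α ih =>
    simp only [maxLetter, List.map_cons, List.foldr_cons, List.mem_cons] at *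
    rcases h with rfl | h
    · omega
    · have := ih h; omega

theorem maxLetter_le {α : SegWord} {k : ℕ} (hk : 1 ≤ k) (h : ∀ l ∈ α, l.1 ≤ k) :
    maxLetter α ≤ k := by
  induction α with
  | nil => simpa [maxLetter] using hk
  | cons l' α ih =>
    have h1 := h l' (by simp)
    have h2 := ih fun l hl => h l (by simp [hl])
    simp only [maxLetter, List.map_cons, List.foldr_cons] at *
    omega

theorem IsParkingQuasiRibbon.le_length {α : SegWord} (h : IsParkingQuasiRibbon α) :
    ∀ l ∈ α, l.1 ≤ α.length := by
  intro l hl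
  obtain ⟨i, hi, rfl⟩ := List.getElem_of_mem hl
  have := h.parking i hi
  omega

theorem IsParkingQuasiRibbon.maxLetter_le_length {α : SegWord} (h : IsParkingQuasiRibbon α) :
    maxLetter α ≤ α.length :=
  maxLetter_le (List.length_pos_iff.2 h.ne_nil) h.le_length

/-- The common part of the three stability proofs. -/
theorem IsParkingQuasiRibbon.append_shift {α β : SegWord} (hα : IsParkingQuasiRibbon α)
    (hβ : IsParkingQuasiRibbon β) (k : ℕ) (hk : k ≤ α.length) (hk' : maxLetter α ≤ k + 1) :
    IsParkingQuasiRibbon (α ++ shift β k) where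
  ne_nil := by simp [hα.ne_nil]
  pos := by
    intro l hl
    rcases List.mem_append.1 hl with hl | hl
    · exact hα.pos l hl
    · simp only [shift, List.mem_map] at hl
      obtain ⟨l', hl', rfl⟩ := hl
      have := hβ.pos l' hl'
      simp only
      omega
  chain := by
    refine List.isChain_append.2 ⟨hα.chain, ?_, ?_⟩
    · refine (List.isChain_map _).2 (hβ.chain.imp ?_)
      intro l l' h
      simpa using h
    · intro l hl l' hl'
      have h1 := le_maxLetter (List.mem_of_getLast? hl)
      simp only [shift, List.head?_map, Option.mem_def, Option.map_eq_some_iff] at hl'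
      obtain ⟨m, hm, rfl⟩ := hl'
      have h2 := hβ.head_no_bar m hm
      have h3 := hβ.pos m (List.mem_of_head? hm)
      simp only [h2]
      refine ⟨by omega, by simp⟩
  parking := by
    intro i hi
    rw [List.getElem_append]
    split_ifs with h
    · exact hα.parking i h
    · simp only [List.length_append, shift, List.length_map] at hi
      have := hβ.parking (i - α.length) (by omega)
      simp only [shift, List.getElem_map]
      omega
  head_no_bar := by
    intro l hl
    refine hα.head_no_bar l ?_
    rwa [List.head?_append_of_ne_nil _ hα.ne_nil] at hl

theorem IsParkingQuasiRibbon.prec {α β : SegWord} (hα : IsParkingQuasiRibbon α)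
    (hβ : IsParkingQuasiRibbon β) : IsParkingQuasiRibbon (wordPrec α β) := by
  have := hα.maxLetter_le_length
  exact hα.append_shift hβ _ (by omega) (by omega)

theorem IsParkingQuasiRibbon.succ {α β : SegWord} (hα : IsParkingQuasiRibbon α)
    (hβ : IsParkingQuasiRibbon β) : IsParkingQuasiRibbon (wordSucc α β) := by
  have := hα.maxLetter_le_length
  exact hα.append_shift hβ _ le_rfl (by omega)

theorem IsParkingQuasiRibbon.circ {α β : SegWord} (hα : IsParkingQuasiRibbon α)
    (hβ : IsParkingQuasiRibbon β) : IsParkingQuasiRibbon (wordCirc α β) := by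
  have h := hα.succ hβ
  have hp := hβ.pos
  rcases β with _ | ⟨l, β⟩
  · exact absurd rfl hβ.ne_nil
  unfold wordCirc
  unfold wordSucc at h
  simp only [shift, List.map_cons, barHead] at h ⊢
  refine ⟨by simp, ?_, ?_, ?_, ?_⟩
  · intro m hm
    rcases List.mem_append.1 hm with hm | hm
    · exact hα.pos m hm
    · rcases List.mem_cons.1 hm with rfl | hm
      · have := hp l (by simp); simp only; omega
      · exact h.pos m (by simp [List.mem_append, List.mem_cons, hm])
  · have hc := List.isChain_append.1 h.chain
    refine List.isChain_append.2 ⟨hc.1, ?_, ?_⟩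
    · have := hc.2.1
      rw [List.isChain_cons] at this ⊢
      exact this
    · intro m hm m' hm'
      have h1 := hα.le_length m (List.mem_of_getLast? hm)
      simp only [List.head?_cons, Option.mem_def, Option.some.injEq] at hm'
      subst hm'
      have := hp l (by simp)
      simp only
      omega
  · intro i hi
    have := h.parking i (by simpa using hi)
    rw [List.getElem_append] at this ⊢
    split_ifs at this ⊢ with hh
    · exact this
    · rw [List.getElem_cons] at this ⊢
      split_ifs at this ⊢ <;> exact this
  · intro m hm
    refine hα.head_no_bar m ?_
    rwa [List.head?_append_of_ne_nil _ hα.ne_nil] at hm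

/-- `α ≺ β = α · β[max(α) - 1]`. -/
def ParkingQuasiRibbon.prec (α β : ParkingQuasiRibbon) : ParkingQuasiRibbon :=
  ⟨wordPrec α.1 β.1, α.2.prec β.2⟩

/-- `α ∘ β = α | β[|α|]`. -/
def ParkingQuasiRibbon.circ (α β : ParkingQuasiRibbon) : ParkingQuasiRibbon :=
  ⟨wordCirc α.1 β.1, α.2.circ β.2⟩

/-- `α ≻ β = α · β[|α|]`. -/
def ParkingQuasiRibbon.succ (α β : ParkingQuasiRibbon) : ParkingQuasiRibbon :=
  ⟨wordSucc α.1 β.1, α.2.succ β.2⟩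

/-! ### From Schröder trees to parking quasi-ribbons -/

/-- Binary trees with two-colored left edges. In `node s l r`, the boolean `s` says whether the
edge from the root to its left subtree `l` has the second color (it is only used with
`s = false` when `l` is empty). -/
inductive ColoredBinaryTree : Type
  | empty : ColoredBinaryTree
  | node (s : Bool) (l r : ColoredBinaryTree) : ColoredBinaryTree

/-- The number of vertices. -/
def ColoredBinaryTree.size : ColoredBinaryTree → ℕ
  | .empty => 0
  | .node _ l r => l.size + r.size + 1

/-- The left comb with subtrees `T_1, …, T_(n+2)`: all the left edges between the `n + 1` vertices
of the comb have the second color, `T_1` hangs on a left edge of the first color (at the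
lowest vertex), and `T_2, …, T_(n+2)` hang, from bottom to top, on right edges. -/
def leftComb : (n : ℕ) → (Fin (n + 2) → ColoredBinaryTree) → ColoredBinaryTree
  | 0, f => .node false (f 0) (f 1)
  | n + 1, f => .node true (leftComb n fun i => f i.castSucc) (f (Fin.last (n + 2)))

/-- The binary tree with two-colored left edges associated with a Schröder tree; leaves
become empty subtrees. -/
def SchroderTree.toBinary : SchroderTree → ColoredBinaryTree
  | .leaf => .empty
  | .node n c => leftComb n fun i => (c i).toBinary

/-- `φ(T) = φ(T₂) · φ(T₁)[max(φ(T₂)) - 1] · (|T₁| + max(φ(T₂)))` for a binary tree with left and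
right subtrees `T₁` and `T₂`. When the edge to `T₁` has the second color, a bar is
inserted between the letters of its two ends, namely the last two letters of `φ(T)`. -/
def ColoredBinaryTree.phi : ColoredBinaryTree → SegWord
  | .empty => []
  | .node s l r =>
      r.phi ++ shift l.phi (maxLetter r.phi - 1) ++ [(l.size + maxLetter r.phi, s)]

/-- The map `φ` from Schröder trees to segmented words. -/
def SchroderTree.phi (T : SchroderTree) : SegWord := T.toBinary.phi

/-! ### Triduplicial algebras -/

/-- The seven triduplicial relations for three binary operations `≺`, `∘`, `≻`. -/
structure TriduplicialRelations {S : Type u} (prec circ succ : S → S → S) : Prop where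
  prec_prec : ∀ x y z, prec (prec x y) z = prec x (prec y z)
  circ_circ : ∀ x y z, circ (circ x y) z = circ x (circ y z)
  succ_succ : ∀ x y z, succ (succ x y) z = succ x (succ y z)
  succ_prec : ∀ x y z, prec (succ x y) z = succ x (prec y z)
  circ_prec : ∀ x y z, prec (circ x y) z = circ x (prec y z)
  succ_circ : ∀ x y z, circ (succ x y) z = succ x (circ y z)
  circ_succ : ∀ x y z, succ (circ x y) z = circ x (succ y z)

/-- A triduplicial algebra structure on the `K`-module `A`: three bilinear operations satisfying
the seven triduplicial relations. -/
structure TriduplicialAlgebra (K : Type u) (A : Type v) [CommRing K] [AddCommGroup A]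
    [Module K A] where
  prec : A →ₗ[K] A →ₗ[K] A
  circ : A →ₗ[K] A →ₗ[K] A
  succ : A →ₗ[K] A →ₗ[K] A
  relations : TriduplicialRelations (fun x y => prec x y) (fun x y => circ x y)
    (fun x y => succ x y)

/-- Morphisms of triduplicial algebras. -/
structure TriduplicialAlgebra.IsHom {K : Type u} {A : Type v} {B : Type w} [CommRing K]
    [AddCommGroup A] [Module K A] [AddCommGroup B] [Module K B]
    (𝒜 : TriduplicialAlgebra K A) (ℬ : TriduplicialAlgebra K B) (f : A →ₗ[K] B) : Prop where
  map_prec : ∀ x y, f (𝒜.prec x y) = ℬ.prec (f x) (f y)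
  map_circ : ∀ x y, f (𝒜.circ x y) = ℬ.circ (f x) (f y)
  map_succ : ∀ x y, f (𝒜.succ x y) = ℬ.succ (f x) (f y)

end Schroder

open Schroder

/-! Everything is read on binary trees with two-coloured left edges. Cutting each Schröder vertex
into a left comb identifies Schröder trees with the trees in which no second-colour edge leads to an
empty subtree (`WellColored`). On these trees `I ≺ J` grafts `I` at the end of the right branch of
`J`, and `I ≻ J`, `I ∘ J` graft `I` to the left of the last vertex of `J`, the colour of the edge
choosing the operation (`code_shape`). Unique readability of Polish codes (`code_append_inj`)
transfers this to pseudocompositions.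

A tree `node s l r` is thus the normal form `r ≺ (l ≻ x)` or `r ≺ (l ∘ x)`, an empty subtree being
omitted with its operation. Hence `x` generates, which gives uniqueness of morphisms. For existence,
`eval` computes the normal form in any target satisfying the relations; it is a morphism because
each of the seven relations is one way of pushing a graft one step down the tree (`eval_graftRight`,
`eval_graftLast`). This needs the relations in the target only.

Parking quasi-ribbons satisfy the relations by comparing shifts, so `φ` can be taken to be the
morphism sending `x` to `1`; `eval_eq_phi` recovers the recursive formula. Bijectivity amounts to
recovering the factorisation `φ(T) = ρ · μ[max ρ - 1] · m`, `m = |μ| + max ρ`, from the word. The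
equation on `m` together with the parking condition on `μ` determines `|ρ|`
(`size_le_of_phi_append_eq`), and taking the longest prefix for which the equation can hold makes
the middle factor parking (`exists_cut`). Since `φ` is injective and preserves the operations, the
relations pull back to pseudocompositions. -/

namespace Schroder

/-! ### Well-coloured binary trees and grafting -/

namespace ColoredBinaryTree

/-- The left edges of the second color do not lead to empty subtrees. -/
def WellColored : ColoredBinaryTree → Prop
  | .empty => True
  | .node s l r => (s = true → l ≠ .empty) ∧ l.WellColored ∧ r.WellColored

/-- Grafting `I` at the end of the rightmost branch. -/
def graftRight (I : ColoredBinaryTree) : ColoredBinaryTree → ColoredBinaryTree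
  | .empty => I
  | .node s l r => .node s l (graftRight I r)

open Classical in
/-- Grafting `I` as left child, on an edge of color `t`, of the last vertex. -/
noncomputable def graftLast (t : Bool) (I : ColoredBinaryTree) :
    ColoredBinaryTree → ColoredBinaryTree
  | .empty => I
  | .node s l r =>
    if r = .empty then
      if l = .empty then .node t I .empty else .node s (graftLast t I l) .empty
    else .node s l (graftLast t I r)

theorem graftRight_ne_empty {I : ColoredBinaryTree} (hI : I ≠ .empty) (J : ColoredBinaryTree) :
    graftRight I J ≠ .empty := by
  cases J <;> simp [graftRight, hI]

theorem graftLast_ne_empty {t : Bool} {I : ColoredBinaryTree} (hI : I ≠ .empty)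
    (J : ColoredBinaryTree) : graftLast t I J ≠ .empty := by
  cases J with
  | empty => simpa [graftLast]
  | node s l r => rw [graftLast]; split_ifs <;> simp

theorem WellColored.graftRight {I J : ColoredBinaryTree} (hI : I.WellColored)
    (hJ : J.WellColored) : (graftRight I J).WellColored := by
  induction J with
  | empty => exact hI
  | node s l r _ ihr => exact ⟨hJ.1, hJ.2.1, ihr hJ.2.2⟩

theorem WellColored.graftLast {t : Bool} {I J : ColoredBinaryTree} (hI : I.WellColored)
    (hne : I ≠ .empty) (hJ : J.WellColored) : (graftLast t I J).WellColored := by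
  induction J with
  | empty => exact hI
  | node s l r ihl ihr =>
    rw [ColoredBinaryTree.graftLast]
    split_ifs with h h'
    · exact ⟨fun _ => hne, hI, trivial⟩
    · exact ⟨fun _ => graftLast_ne_empty hne l, ihl hJ.2.1, trivial⟩
    · exact ⟨hJ.1, hJ.2.1, ihr hJ.2.2⟩

/-! ### Evaluation in a set with three operations -/

section Eval

variable {S : Type u} (prec circ succ : S → S → S) (a : S)

open Classical in
/-- The element obtained from `a` by the expression `r ≺ (l ≻ a)` or `r ≺ (l ∘ a)` encoded by
a binary tree. -/
noncomputable def eval : ColoredBinaryTree → S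
  | .empty => a
  | .node s l r =>
    let q := if l = .empty then a else (if s then circ else succ) (eval l) a
    if r = .empty then q else prec (eval r) q

variable {prec circ succ}

/-- Descending along the right branch is one use of `prec_prec` per vertex. -/
theorem eval_graftRight (h : TriduplicialRelations prec circ succ) {I J : ColoredBinaryTree}
    (hI : I ≠ .empty) (hJ : J ≠ .empty) :
    eval prec circ succ a (graftRight I J) =
      prec (eval prec circ succ a I) (eval prec circ succ a J) := by
  induction J with
  | empty => exact absurd rfl hJ
  | node s l r _ ihr =>
    by_cases hr : r = .empty
    · subst hr
      simp [graftRight, eval, hI]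
    · simp only [graftRight, eval, graftRight_ne_empty hI, hr, if_false, ihr hr, h.prec_prec]

/-- A graft passes a right edge by `succ_prec` or `circ_prec`, and a left edge by one of the four
relations between `∘` and `≻`, selected by the colours `s` of the edge and `t` of the graft. At the
last vertex the old colour `s` is discarded; this is harmless, since `eval` ignores the colour above
an empty subtree. -/
theorem eval_graftLast (h : TriduplicialRelations prec circ succ) (t : Bool)
    {I J : ColoredBinaryTree} (hI : I ≠ .empty) (hJ : J ≠ .empty) :
    eval prec circ succ a (graftLast t I J) =
      (if t then circ else succ) (eval prec circ succ a I) (eval prec circ succ a J) := by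
  induction J with
  | empty => exact absurd rfl hJ
  | node s l r ihl ihr =>
    by_cases hr : r = .empty
    · subst hr
      by_cases hl : l = .empty
      · subst hl
        simp [graftLast, eval, hI]
      · simp only [graftLast, eval, graftLast_ne_empty hI, hl, if_false, if_true, ihl hl]
        cases s <;> cases t <;>
          simp [h.succ_succ, h.circ_circ, h.succ_circ, h.circ_succ]
    · simp only [graftLast, eval, graftLast_ne_empty hI, hr, if_false, ihr hr]
      cases t <;> simp [h.succ_prec, h.circ_prec]

end Eval

/-! ### Polish codes of binary trees -/

/-- The first entry is increased by one. -/
def incHead : List ℕ → List ℕ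
  | [] => []
  | a :: w => (a + 1) :: w

/-- The Polish code of the Schröder tree encoded by a binary tree. -/
def code : ColoredBinaryTree → List ℕ
  | .empty => [0]
  | .node s l r => (if s then incHead l.code else 1 :: l.code) ++ r.code

theorem exists_incHead (a : List ℕ) (k : ℕ) : ∃ a' k', ∀ i w,
    incHead (a ++ (k + 1 + i) :: w) = a' ++ (k' + 1 + i) :: w := by
  cases a with
  | nil => exact ⟨[], k + 1, fun i w => by simp [incHead]; omega⟩
  | cons x a => exact ⟨(x + 1) :: a, k, fun i w => by simp [incHead]⟩

/-- Uniformity in `i` and `w` is the point: the same prefix must serve for the code of a tree and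
for all grafts on it. -/
theorem exists_prefix (s : Bool) (a : List ℕ) (k : ℕ) : ∃ a' k', ∀ i w,
    (if s then incHead (a ++ (k + 1 + i) :: w) else 1 :: (a ++ (k + 1 + i) :: w)) =
      a' ++ (k' + 1 + i) :: w := by
  cases s with
  | false => exact ⟨1 :: a, k, fun i w => by simp⟩
  | true => simpa using exists_incHead a k

/-- The grafts act near the last positive entry: on the final zero, on the first zero after this
entry, or by merging with the entry itself. All of them are treated in one induction so that they
share `a`, `k` and `m`. -/
theorem code_shape {J : ColoredBinaryTree} (hJ : J.WellColored) (hne : J ≠ .empty) :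
    ∃ a k m, J.code = a ++ (k + 1) :: List.replicate (m + 1) 0 ∧ ∀ I : ColoredBinaryTree,
      (graftRight I J).code = a ++ (k + 1) :: (List.replicate m 0 ++ I.code) ∧
      (graftLast false I J).code = a ++ (k + 1) :: (I.code ++ List.replicate m 0) ∧
      ∀ i w, I.code = i :: w →
        (graftLast true I J).code = a ++ (k + 1 + i) :: (w ++ List.replicate m 0) := by
  induction J with
  | empty => exact absurd rfl hne
  | node s l r ihl ihr =>
    by_cases hr : r = .empty
    · subst hr
      by_cases hl : l = .empty
      · subst hl
        cases s with
        | true => exact absurd rfl (hJ.1 rfl)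
        | false =>
          refine ⟨[], 0, 1, rfl, fun I => ⟨?_, ?_, fun i w hw => ?_⟩⟩
          · simp [graftRight, code]
          · simp [graftLast, code]
          · simp [graftLast, code, hw, incHead, add_comm]
      · obtain ⟨a, k, m, h, hg⟩ := ihl hJ.2.1 hl
        obtain ⟨a', k', h'⟩ := exists_prefix s a k
        have h0 := h' 0
        simp only [add_zero] at h0
        -- The empty right subtree contributes one more trailing zero.
        refine ⟨a', k', m + 1, ?_, fun I => ⟨?_, ?_, fun i w hw => ?_⟩⟩
        · rw [code, h, h0, List.replicate_succ' (n := m + 1)]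
          simp [code]
        · rw [graftRight, code, h, h0]
          simp [graftRight]
        · rw [graftLast, if_pos rfl, if_neg hl, code, (hg I).2.1, h0, List.replicate_succ' (n := m)]
          simp [code]
        · rw [graftLast, if_pos rfl, if_neg hl, code, (hg I).2.2 i w hw, h',
            List.replicate_succ' (n := m)]
          simp [code]
    · obtain ⟨a, k, m, h, hg⟩ := ihr hJ.2.2 hr
      refine ⟨_ ++ a, k, m, by rw [code, h, List.append_assoc], fun I => ⟨?_, ?_, fun i w hw => ?_⟩⟩
      · rw [graftRight, code, (hg I).1, List.append_assoc]
      · rw [graftLast, if_neg hr, code, (hg I).2.1, List.append_assoc]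
      · rw [graftLast, if_neg hr, code, (hg I).2.2 i w hw, List.append_assoc]

theorem stem_append_replicate (a : List ℕ) (k m : ℕ) :
    stem (a ++ (k + 1) :: List.replicate m 0) = a ++ [k + 1] := by
  induction m with
  | zero => simp [stem]
  | succ m ih =>
    rw [List.replicate_succ', ← List.cons_append, ← List.append_assoc, stem,
      List.rdropWhile_concat]
    simpa [stem] using ih

theorem zeros_append_replicate (a : List ℕ) (k m : ℕ) :
    zeros (a ++ (k + 1) :: List.replicate m 0) = m := by
  have h := congrArg List.length (stem_append_zeros (a ++ (k + 1) :: List.replicate m 0))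
  rw [stem_append_replicate] at h
  simp at h
  omega

theorem exists_code_eq_cons (I : ColoredBinaryTree) : ∃ i w, I.code = i :: w := by
  induction I with
  | empty => exact ⟨0, [], rfl⟩
  | node s l r ihl _ =>
    obtain ⟨i, w, h⟩ := ihl
    cases s <;> simp [code, h, incHead]

theorem code_graftRight (I : ColoredBinaryTree) {J : ColoredBinaryTree}
    (hJ : J.WellColored) (hne : J ≠ .empty) :
    (graftRight I J).code = codePrec I.code J.code := by
  obtain ⟨a, k, m, h, hg⟩ := code_shape hJ hne
  rw [(hg I).1, h, codePrec, stem_append_replicate, zeros_append_replicate]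
  simp

theorem code_graftLast_false (I : ColoredBinaryTree) {J : ColoredBinaryTree}
    (hJ : J.WellColored) (hne : J ≠ .empty) :
    (graftLast false I J).code = codeSucc I.code J.code := by
  obtain ⟨a, k, m, h, hg⟩ := code_shape hJ hne
  rw [(hg I).2.1, h, codeSucc, stem_append_replicate, zeros_append_replicate]
  simp

theorem code_graftLast_true (I : ColoredBinaryTree) {J : ColoredBinaryTree}
    (hJ : J.WellColored) (hne : J ≠ .empty) :
    (graftLast true I J).code = codeCirc I.code J.code := by
  obtain ⟨a, k, m, h, hg⟩ := code_shape hJ hne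
  obtain ⟨i, w, hw⟩ := exists_code_eq_cons I
  rw [(hg I).2.2 i w hw, h, codeCirc, stem_append_replicate, zeros_append_replicate, hw,
    nearConcat_concat_cons]
  simp

end ColoredBinaryTree

/-! ### Schröder trees and binary trees -/

open ColoredBinaryTree

/-- Each second-colour edge merges a vertex with its left child: the head of the code grows by one
and the right subtree becomes the new last child. -/
theorem code_leftComb (n : ℕ) (f : Fin (n + 2) → ColoredBinaryTree) :
    (leftComb n f).code = (n + 1) :: (List.ofFn fun i => (f i).code).flatten := by
  induction n with
  | zero => simp [leftComb, ColoredBinaryTree.code, List.ofFn_succ]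
  | succ n ih =>
    rw [leftComb, ColoredBinaryTree.code, ih, List.ofFn_succ_last (f := fun i => (f i).code)]
    simp only [incHead, if_true, List.flatten_append, List.flatten_cons, List.flatten_nil,
      List.append_nil, List.cons_append]

theorem leftComb_ne_empty (n : ℕ) (f : Fin (n + 2) → ColoredBinaryTree) :
    leftComb n f ≠ .empty := by
  cases n <;> simp [leftComb]

theorem wellColored_leftComb (n : ℕ) (f : Fin (n + 2) → ColoredBinaryTree)
    (hf : ∀ i, (f i).WellColored) : (leftComb n f).WellColored := by
  induction n with
  | zero => exact ⟨by simp, hf _, hf _⟩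
  | succ n ih => exact ⟨fun _ => leftComb_ne_empty _ _, ih _ fun i => hf _, hf _⟩

namespace SchroderTree

theorem toBinary_code (T : SchroderTree) : T.toBinary.code = T.code := by
  induction T with
  | leaf => rfl
  | node n c ih => simp [toBinary, code_leftComb, SchroderTree.code, ih]

theorem toBinary_wellColored (T : SchroderTree) : T.toBinary.WellColored := by
  induction T with
  | leaf => trivial
  | node n c ih => exact wellColored_leftComb _ _ ih

theorem toBinary_node_ne_empty (n : ℕ) (c : Fin (n + 2) → SchroderTree) :
    (SchroderTree.node n c).toBinary ≠ .empty := leftComb_ne_empty _ _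

/-- A second-colour edge leads to a nonempty tree, hence to a Schröder tree with an internal root,
which receives the right subtree as an extra last child. -/
theorem exists_toBinary_eq {b : ColoredBinaryTree} (hb : b.WellColored) :
    ∃ T : SchroderTree, T.toBinary = b := by
  induction b with
  | empty => exact ⟨.leaf, rfl⟩
  | node s l r ihl ihr =>
    obtain ⟨hs, hl, hr⟩ := hb
    obtain ⟨L, rfl⟩ := ihl hl
    obtain ⟨R, rfl⟩ := ihr hr
    cases s with
    | false => exact ⟨.node 0 ![L, R], rfl⟩
    | true =>
      cases L with
      | leaf => exact absurd rfl (hs rfl)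
      | node n c =>
        refine ⟨.node (n + 1) (Fin.snoc (α := fun _ => SchroderTree) c R), ?_⟩
        simp only [toBinary, leftComb, Fin.snoc_castSucc, Fin.snoc_last]

/-- Polish codes are uniquely readable. -/
theorem code_append_inj (T T' : SchroderTree) (u u' : List ℕ)
    (h : T.code ++ u = T'.code ++ u') : T = T' ∧ u = u' := by
  induction T generalizing T' u u' with
  | leaf =>
    cases T' with
    | leaf => simpa [code] using h
    | node n c => simp [code] at h
  | node n c ih =>
    cases T' with
    | leaf => simp [code] at h
    | node n' c' =>
      simp only [code, List.cons_append, List.cons.injEq, Nat.add_right_cancel_iff] at h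
      obtain ⟨rfl, h⟩ := h
      -- Unique readability of forests, reading one tree at a time.
      have key : ∀ (m : ℕ) (d d' : Fin m → SchroderTree),
          (∀ i T' u u', (d i).code ++ u = T'.code ++ u' → d i = T' ∧ u = u') →
          (List.ofFn fun i => (d i).code).flatten ++ u =
            (List.ofFn fun i => (d' i).code).flatten ++ u' → d = d' ∧ u = u' := by
        intro m d d' hd h
        induction m with
        | zero => exact ⟨Subsingleton.elim _ _, by simpa using h⟩
        | succ m ihm =>
          simp only [List.ofFn_succ, List.flatten_cons, List.append_assoc] at h
          obtain ⟨h0, h⟩ := hd 0 _ _ _ h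
          obtain ⟨h1, h⟩ := ihm (fun i => d i.succ) (fun i => d' i.succ) (fun i => hd i.succ) h
          refine ⟨funext fun i => Fin.cases h0 (fun j => congrFun h1 j) i, h⟩
      obtain ⟨hc, hu⟩ := key _ c c' ih h
      exact ⟨by rw [hc], hu⟩

theorem code_injective : Function.Injective SchroderTree.code := fun T T' h =>
  (code_append_inj T T' [] [] (by rw [h])).1

end SchroderTree

theorem ColoredBinaryTree.WellColored.eq_of_code_eq {b b' : ColoredBinaryTree}
    (hb : b.WellColored) (hb' : b'.WellColored) (h : b.code = b'.code) : b = b' := by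
  obtain ⟨T, rfl⟩ := SchroderTree.exists_toBinary_eq hb
  obtain ⟨T', rfl⟩ := SchroderTree.exists_toBinary_eq hb'
  rw [SchroderTree.toBinary_code, SchroderTree.toBinary_code] at h
  rw [SchroderTree.code_injective h]

/-! ### Pseudocompositions and binary trees -/

namespace Pseudocomposition

theorem exists_binary (I : Pseudocomposition) :
    ∃ b : ColoredBinaryTree, b.WellColored ∧ b ≠ .empty ∧ b.code = I.1 := by
  obtain ⟨I, n, c, rfl⟩ := I
  exact ⟨_, SchroderTree.toBinary_wellColored _, SchroderTree.toBinary_node_ne_empty n c,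
    SchroderTree.toBinary_code _⟩

/-- The binary tree with two-colored left edges encoding a pseudocomposition. -/
noncomputable def toBinary (I : Pseudocomposition) : ColoredBinaryTree := I.exists_binary.choose

theorem toBinary_wellColored (I : Pseudocomposition) : I.toBinary.WellColored :=
  I.exists_binary.choose_spec.1

theorem toBinary_ne_empty (I : Pseudocomposition) : I.toBinary ≠ .empty :=
  I.exists_binary.choose_spec.2.1

theorem toBinary_code (I : Pseudocomposition) : I.toBinary.code = I.1 :=
  I.exists_binary.choose_spec.2.2

theorem toBinary_eq {I : Pseudocomposition} {b : ColoredBinaryTree} (hb : b.WellColored)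
    (h : b.code = I.1) : I.toBinary = b :=
  I.toBinary_wellColored.eq_of_code_eq hb (I.toBinary_code.trans h.symm)

theorem toBinary_injective : Function.Injective toBinary := fun I J h =>
  Subtype.ext (by rw [← toBinary_code, h, toBinary_code])

theorem exists_toBinary_eq {b : ColoredBinaryTree} (hb : b.WellColored) (hne : b ≠ .empty) :
    ∃ I : Pseudocomposition, I.toBinary = b := by
  obtain ⟨T, rfl⟩ := SchroderTree.exists_toBinary_eq hb
  cases T with
  | leaf => exact absurd rfl hne
  | node n c => exact ⟨ofNode n c, toBinary_eq hb (SchroderTree.toBinary_code _)⟩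

theorem toBinary_ofNode (n : ℕ) (c : Fin (n + 2) → SchroderTree) :
    (ofNode n c).toBinary = (SchroderTree.node n c).toBinary :=
  toBinary_eq (SchroderTree.toBinary_wellColored _) (SchroderTree.toBinary_code _)

theorem toBinary_x : x.toBinary = .node false .empty .empty :=
  toBinary_eq ⟨by simp, trivial, trivial⟩ rfl

theorem toBinary_prec (I J : Pseudocomposition) :
    (I.prec J).toBinary = graftRight I.toBinary J.toBinary :=
  toBinary_eq (I.toBinary_wellColored.graftRight J.toBinary_wellColored)
    (by rw [code_graftRight _ J.toBinary_wellColored J.toBinary_ne_empty, toBinary_code,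
      toBinary_code]; rfl)

theorem toBinary_circ (I J : Pseudocomposition) :
    (I.circ J).toBinary = graftLast true I.toBinary J.toBinary :=
  toBinary_eq (I.toBinary_wellColored.graftLast I.toBinary_ne_empty J.toBinary_wellColored)
    (by rw [code_graftLast_true _ J.toBinary_wellColored J.toBinary_ne_empty, toBinary_code,
      toBinary_code]; rfl)

theorem toBinary_succ (I J : Pseudocomposition) :
    (I.succ J).toBinary = graftLast false I.toBinary J.toBinary :=
  toBinary_eq (I.toBinary_wellColored.graftLast I.toBinary_ne_empty J.toBinary_wellColored)
    (by rw [code_graftLast_false _ J.toBinary_wellColored J.toBinary_ne_empty, toBinary_code,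
      toBinary_code]; rfl)

/-- The pseudocompositions are generated by `x`. -/
theorem generated {P : Pseudocomposition → Prop} (hx : P x)
    (hprec : ∀ I J, P I → P J → P (I.prec J)) (hcirc : ∀ I J, P I → P J → P (I.circ J))
    (hsucc : ∀ I J, P I → P J → P (I.succ J)) (I : Pseudocomposition) : P I := by
  have key : ∀ b : ColoredBinaryTree, ∀ I : Pseudocomposition, I.toBinary = b → P I := by
    intro b
    induction b with
    | empty => exact fun I h => absurd h I.toBinary_ne_empty
    | node s l r ihl ihr =>
      intro I hI
      have hwf := I.toBinary_wellColored
      rw [hI] at hwf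
      obtain ⟨hs, hl, hr⟩ := hwf
      -- `Q` is the right operand of the normal form: `x`, `L ≻ x` or `L ∘ x`.
      have hq : ∃ Q : Pseudocomposition, Q.toBinary = .node s l .empty ∧ P Q := by
        by_cases hle : l = .empty
        · subst hle
          cases s with
          | false => exact ⟨x, toBinary_x, hx⟩
          | true => exact absurd rfl (hs rfl)
        · obtain ⟨L, hL⟩ := exists_toBinary_eq hl hle
          cases s with
          | false =>
            exact ⟨L.succ x, by simp [toBinary_succ, toBinary_x, graftLast, hL],
              hsucc _ _ (ihl L hL) hx⟩
          | true =>
            exact ⟨L.circ x, by simp [toBinary_circ, toBinary_x, graftLast, hL],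
              hcirc _ _ (ihl L hL) hx⟩
      obtain ⟨Q, hQ, hPQ⟩ := hq
      by_cases hre : r = .empty
      · subst hre
        rwa [toBinary_injective (hI.trans hQ.symm)]
      · obtain ⟨R, hR⟩ := exists_toBinary_eq hr hre
        rw [toBinary_injective (show I.toBinary = (R.prec Q).toBinary by
          simp [toBinary_prec, hQ, hR, hI, graftRight])]
        exact hprec _ _ (ihr R hR) hPQ
  exact key _ I rfl

/-- The morphism from the pseudocompositions to a set with three operations sending `x` to `a`. -/
noncomputable def lift {S : Type u} (prec circ succ : S → S → S) (a : S)
    (I : Pseudocomposition) : S :=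
  eval prec circ succ a I.toBinary

section Lift

variable {S : Type u} {prec circ succ : S → S → S} (a : S)

theorem lift_x : lift prec circ succ a x = a := by simp [lift, toBinary_x, eval]

theorem lift_prec (h : TriduplicialRelations prec circ succ) (I J : Pseudocomposition) :
    lift prec circ succ a (I.prec J) =
      prec (lift prec circ succ a I) (lift prec circ succ a J) := by
  rw [lift, toBinary_prec]
  exact eval_graftRight a h I.toBinary_ne_empty J.toBinary_ne_empty

theorem lift_circ (h : TriduplicialRelations prec circ succ) (I J : Pseudocomposition) :
    lift prec circ succ a (I.circ J) =
      circ (lift prec circ succ a I) (lift prec circ succ a J) := by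
  rw [lift, toBinary_circ]
  exact eval_graftLast a h true I.toBinary_ne_empty J.toBinary_ne_empty

theorem lift_succ (h : TriduplicialRelations prec circ succ) (I J : Pseudocomposition) :
    lift prec circ succ a (I.succ J) =
      succ (lift prec circ succ a I) (lift prec circ succ a J) := by
  rw [lift, toBinary_succ]
  exact eval_graftLast a h false I.toBinary_ne_empty J.toBinary_ne_empty

end Lift

end Pseudocomposition

/-! ### Words -/

theorem shift_append (α β : SegWord) (k : ℕ) : shift (α ++ β) k = shift α k ++ shift β k := by
  simp [shift]

theorem shift_shift (α : SegWord) (k k' : ℕ) : shift (shift α k) k' = shift α (k + k') := by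
  simp [shift, add_assoc]

theorem length_shift (α : SegWord) (k : ℕ) : (shift α k).length = α.length := by simp [shift]

theorem shift_zero (α : SegWord) : shift α 0 = α := by simp [shift]

theorem shift_barHead (α : SegWord) (k : ℕ) : shift (barHead α) k = barHead (shift α k) := by
  cases α <;> simp [shift, barHead]

theorem length_barHead (α : SegWord) : (barHead α).length = α.length := by
  cases α <;> simp [barHead]

theorem barHead_append {α : SegWord} (h : α ≠ []) (β : SegWord) :
    barHead (α ++ β) = barHead α ++ β := by
  cases α
  · exact absurd rfl h
  · rfl

theorem maxLetter_barHead (α : SegWord) : maxLetter (barHead α) = maxLetter α := by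
  cases α <;> simp [barHead, maxLetter]

theorem maxLetter_cons (l : ℕ × Bool) (α : SegWord) :
    maxLetter (l :: α) = max l.1 (maxLetter α) := rfl

theorem maxLetter_append (α β : SegWord) :
    maxLetter (α ++ β) = max (maxLetter α) (maxLetter β) := by
  induction α with
  | nil => have := one_le_maxLetter β; simp [maxLetter] at *; omega
  | cons l α ih => simp [maxLetter_cons, ih, max_assoc]

/-- The term `k + 1` corrects for the convention `max(∅) = 1`, which does not commute with shifting.
-/
theorem max_maxLetter_shift (β : SegWord) (k : ℕ) :
    max (k + 1) (maxLetter (shift β k)) = maxLetter β + k := by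
  induction β with
  | nil => simp [shift, maxLetter]; omega
  | cons l β ih =>
    have e : maxLetter (shift (l :: β) k) = max (l.1 + k) (maxLetter (shift β k)) := rfl
    rw [e, maxLetter_cons]
    omega

theorem maxLetter_wordPrec (α β : SegWord) :
    maxLetter (wordPrec α β) = maxLetter β + (maxLetter α - 1) := by
  have h := max_maxLetter_shift β (maxLetter α - 1)
  have := one_le_maxLetter α
  rw [wordPrec, maxLetter_append, ← h]
  omega

theorem maxLetter_wordSucc {α β : SegWord} (hα : maxLetter α ≤ α.length + 1)
    (hβ : IsParkingQuasiRibbon β) : maxLetter (wordSucc α β) = maxLetter β + α.length := by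
  have h := max_maxLetter_shift β α.length
  rw [wordSucc, maxLetter_append]
  rcases β with _ | ⟨l, β⟩
  · exact absurd rfl hβ.ne_nil
  have h1 := hβ.pos l (by simp)
  have h2 : l.1 + α.length ≤ maxLetter (shift (l :: β) α.length) :=
    le_maxLetter (l := (l.1 + α.length, l.2)) (by simp [shift])
  omega

theorem maxLetter_wordCirc {α β : SegWord} (hα : maxLetter α ≤ α.length + 1)
    (hβ : IsParkingQuasiRibbon β) : maxLetter (wordCirc α β) = maxLetter β + α.length := by
  rw [← maxLetter_wordSucc hα hβ, wordCirc, wordSucc, maxLetter_append, maxLetter_append,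
    maxLetter_barHead]

theorem shift_ne_nil {α : SegWord} (h : α ≠ []) (k : ℕ) : shift α k ≠ [] := by
  simpa [shift] using h

/-- Both sides concatenate the same three words, so only shifts and bars need comparing. When the
outer operation on the left is `≺`, the shift of `z` is governed by the maximum of a product. A bar
put before a product falls before its first factor, which is nonempty. -/
theorem ParkingQuasiRibbon.relations : TriduplicialRelations ParkingQuasiRibbon.prec
    ParkingQuasiRibbon.circ ParkingQuasiRibbon.succ := by
  have hm : ∀ x : ParkingQuasiRibbon, maxLetter x.1 ≤ x.1.length + 1 := fun x =>
    x.2.maxLetter_le_length.trans (Nat.le_succ _)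
  have hn : ∀ (x : ParkingQuasiRibbon) (k : ℕ), shift x.1 k ≠ [] := fun x k =>
    shift_ne_nil x.2.ne_nil k
  have h1 := one_le_maxLetter
  constructor <;> intro x y z <;> apply Subtype.ext
  · change wordPrec (wordPrec x.1 y.1) z.1 = wordPrec x.1 (wordPrec y.1 z.1)
    have e : maxLetter (wordPrec x.1 y.1) - 1 = maxLetter y.1 - 1 + (maxLetter x.1 - 1) := by
      rw [maxLetter_wordPrec]; have := h1 y.1; omega
    rw [wordPrec, e]
    simp only [wordPrec, shift_append, shift_shift, List.append_assoc]
  · change wordCirc (wordCirc x.1 y.1) z.1 = wordCirc x.1 (wordCirc y.1 z.1)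
    simp only [wordCirc, shift_append, shift_shift, List.append_assoc, List.length_append,
      shift_barHead, length_barHead, length_shift, barHead_append (hn y _), add_comm]
  · change wordSucc (wordSucc x.1 y.1) z.1 = wordSucc x.1 (wordSucc y.1 z.1)
    simp only [wordSucc, shift_append, shift_shift, List.append_assoc, List.length_append,
      length_shift, add_comm]
  · change wordPrec (wordSucc x.1 y.1) z.1 = wordSucc x.1 (wordPrec y.1 z.1)
    have e : maxLetter (wordSucc x.1 y.1) - 1 = maxLetter y.1 - 1 + x.1.length := by
      rw [maxLetter_wordSucc (hm x) y.2]; have := h1 y.1; omega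
    rw [wordPrec, e]
    simp only [wordSucc, wordPrec, shift_append, shift_shift, List.append_assoc]
  · change wordPrec (wordCirc x.1 y.1) z.1 = wordCirc x.1 (wordPrec y.1 z.1)
    have e : maxLetter (wordCirc x.1 y.1) - 1 = maxLetter y.1 - 1 + x.1.length := by
      rw [maxLetter_wordCirc (hm x) y.2]; have := h1 y.1; omega
    rw [wordPrec, e]
    simp only [wordCirc, wordPrec, shift_append, shift_shift, List.append_assoc,
      barHead_append (hn y _)]
  · change wordCirc (wordSucc x.1 y.1) z.1 = wordSucc x.1 (wordCirc y.1 z.1)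
    simp only [wordCirc, wordSucc, shift_append, shift_shift, List.append_assoc,
      List.length_append, shift_barHead, length_shift, add_comm]
  · change wordSucc (wordCirc x.1 y.1) z.1 = wordCirc x.1 (wordSucc y.1 z.1)
    simp only [wordCirc, wordSucc, shift_append, shift_shift, List.append_assoc,
      List.length_append, length_barHead, length_shift, barHead_append (hn y _), add_comm]

/-! ### The map `φ` on binary trees -/

theorem isParkingQuasiRibbon_one : IsParkingQuasiRibbon [(1, false)] where
  ne_nil := by simp
  pos := by simp
  chain := by simp
  parking := by intro i hi; simp at hi; simp [hi]
  head_no_bar := by simp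

/-- The parking quasi-ribbon `1`. -/
def ParkingQuasiRibbon.one : ParkingQuasiRibbon := ⟨[(1, false)], isParkingQuasiRibbon_one⟩

theorem ParkingQuasiRibbon.val_one : ParkingQuasiRibbon.one.1 = [(1, false)] := rfl

theorem ColoredBinaryTree.length_phi (b : ColoredBinaryTree) : b.phi.length = b.size := by
  induction b with
  | empty => rfl
  | node s l r ihl ihr => simp [phi, size, length_shift, ihl, ihr]; omega

/-- The last letter is `|l| + 1` shifted by `max - 1`, so the formula for `φ` is itself a
`≺`-product. -/
theorem ColoredBinaryTree.phi_node (s : Bool) (l r : ColoredBinaryTree) :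
    (node s l r).phi = wordPrec r.phi (l.phi ++ [(l.size + 1, s)]) := by
  have := one_le_maxLetter r.phi
  rw [phi, wordPrec, shift_append, List.append_assoc]
  simp only [shift, List.map_cons, List.map_nil]
  rw [show l.size + 1 + (maxLetter r.phi - 1) = l.size + maxLetter r.phi by omega]

/-- Appending the letter `|l| + 1`, barred or not, is `φ(l) ∘ 1` or `φ(l) ≻ 1`, so `φ` evaluates the
normal form at `1`. -/
theorem ColoredBinaryTree.WellColored.eval_eq_phi {b : ColoredBinaryTree} (hb : b.WellColored)
    (hne : b ≠ .empty) :
    (eval ParkingQuasiRibbon.prec ParkingQuasiRibbon.circ ParkingQuasiRibbon.succ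
      ParkingQuasiRibbon.one b).1 = b.phi := by
  induction b with
  | empty => exact absurd rfl hne
  | node s l r ihl ihr =>
    obtain ⟨hs, hl, hr⟩ := hb
    have hq : (eval ParkingQuasiRibbon.prec ParkingQuasiRibbon.circ ParkingQuasiRibbon.succ
        ParkingQuasiRibbon.one (node s l empty)).1 = l.phi ++ [(l.size + 1, s)] := by
      by_cases hle : l = .empty
      · subst hle
        cases s
        · simp [eval, phi, size, ParkingQuasiRibbon.one]
        · exact absurd rfl (hs rfl)
      · have h := ihl hl hle
        cases s
        · simp [eval, hle, ParkingQuasiRibbon.succ, wordSucc, h, ParkingQuasiRibbon.val_one,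
            shift, length_phi, add_comm]
        · simp [eval, hle, ParkingQuasiRibbon.circ, wordCirc, h, ParkingQuasiRibbon.val_one,
            shift, length_phi, add_comm, barHead]
    rw [phi_node]
    by_cases hre : r = .empty
    · subst hre
      rw [hq, wordPrec]
      simp [phi, maxLetter, shift_zero]
    · rw [← ihr hr hre, ← hq]
      simp [eval, hre, ParkingQuasiRibbon.prec]

theorem ColoredBinaryTree.WellColored.isParkingQuasiRibbon_phi {b : ColoredBinaryTree}
    (hb : b.WellColored) (hne : b ≠ .empty) : IsParkingQuasiRibbon b.phi := by
  rw [← hb.eval_eq_phi hne]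
  exact Subtype.prop _

/-! ### Injectivity of `φ` -/

theorem ColoredBinaryTree.WellColored.phi_le {b : ColoredBinaryTree} (hb : b.WellColored) (i : ℕ)
    (hi : i < b.phi.length) : (b.phi[i]).1 ≤ i + 1 := by
  by_cases hne : b = .empty
  · subst hne
    simp [phi] at hi
  · exact (hb.isParkingQuasiRibbon_phi hne).parking i hi

/-- In `φ(T)`, the first factor `φ(T₂)` cannot be a proper prefix of another possible factor. -/
theorem size_le_of_phi_append_eq {l r l' r' : ColoredBinaryTree} (hl : l.WellColored)
    (hs : l.size + maxLetter r.phi = l'.size + maxLetter r'.phi)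
    (h : r.phi ++ shift l.phi (maxLetter r.phi - 1) =
      r'.phi ++ shift l'.phi (maxLetter r'.phi - 1)) : r'.size ≤ r.size := by
  by_contra! hlt
  have hlen := congrArg List.length h
  simp only [List.length_append, length_shift, length_phi] at hlen
  obtain ⟨δ, hδ, hδ'⟩ := List.append_eq_append_iff.1 h |>.resolve_right (by
    rintro ⟨c, hc, -⟩
    have := congrArg List.length hc
    simp only [List.length_append, length_phi] at this
    omega)
  have hδl : r'.size = r.size + δ.length := by
    have := congrArg List.length hδ
    simpa only [List.length_append, length_phi] using this
  have h1 := one_le_maxLetter r.phi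
  -- `δ` is a prefix of the shifted `φ(l)`, so the parking condition bounds its letters.
  have hmax : maxLetter δ ≤ δ.length + (maxLetter r.phi - 1) := by
    refine maxLetter_le (by omega) fun m hm => ?_
    obtain ⟨i, hi, rfl⟩ := List.getElem_of_mem hm
    have hi' : i < l.phi.length := by
      have := congrArg List.length hδ'
      simp only [List.length_append, length_shift] at this
      omega
    have e : δ[i] = (shift l.phi (maxLetter r.phi - 1))[i]'(by rwa [length_shift]) := by
      simp only [hδ', List.getElem_append_left hi]
    have := hl.phi_le i hi'
    simp only [e, shift, List.getElem_map]
    omega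
  -- Equality of the last letters would require `max φ(r') = max φ(r) + |δ|`, which exceeds the
  -- bound by one.
  rw [hδ, maxLetter_append] at hs
  omega

theorem shift_injective (k : ℕ) : Function.Injective fun α : SegWord => shift α k :=
  List.map_injective_iff.2 fun l l' h => by
    simp only [Prod.mk.injEq, Nat.add_right_cancel_iff] at h
    exact Prod.ext h.1 h.2

theorem ColoredBinaryTree.WellColored.eq_of_phi_eq {b b' : ColoredBinaryTree}
    (hb : b.WellColored) (hb' : b'.WellColored) (h : b.phi = b'.phi) : b = b' := by
  induction b generalizing b' with
  | empty =>
    cases b' with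
    | empty => rfl
    | node s l r => simp [phi] at h
  | node s l r ihl ihr =>
    cases b' with
    | empty => simp [phi] at h
    | node s' l' r' =>
      simp only [phi] at h
      obtain ⟨h, hs⟩ := List.append_inj' h rfl
      simp only [List.cons.injEq, Prod.mk.injEq, and_true] at hs
      have hr := le_antisymm (size_le_of_phi_append_eq hb'.2.1 hs.1.symm h.symm)
        (size_le_of_phi_append_eq hb.2.1 hs.1 h)
      obtain ⟨hr, hl⟩ := List.append_inj h (by simpa only [length_phi] using hr)
      rw [ihr hb.2.2 hb'.2.2 hr] at hl ⊢
      rw [ihl hb.2.1 hb'.2.1 (shift_injective _ hl), hs.2]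

/-! ### Surjectivity of `φ` -/

theorem IsParkingQuasiRibbon.pairwise {α : SegWord} (h : IsParkingQuasiRibbon α) :
    α.Pairwise fun l l' => l.1 ≤ l'.1 ∧ (l'.2 = true → l.1 ≠ l'.1) := by
  have : IsTrans (ℕ × Bool) fun l l' => l.1 ≤ l'.1 ∧ (l'.2 = true → l.1 ≠ l'.1) :=
    ⟨fun a b c hab hbc => ⟨hab.1.trans hbc.1, fun hc => by
      have := hbc.2 hc; have := hab.1; have := hbc.1; omega⟩⟩
  exact List.isChain_iff_pairwise.1 h.chain

theorem IsParkingQuasiRibbon.of_append {α β : SegWord} (h : IsParkingQuasiRibbon (α ++ β))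
    (hα : α ≠ []) : IsParkingQuasiRibbon α where
  ne_nil := hα
  pos l hl := h.pos l (by simp [hl])
  chain := (List.isChain_append.1 h.chain).1
  parking i hi := by
    have := h.parking i (by simp; omega)
    rwa [List.getElem_append_left hi] at this
  head_no_bar l hl := h.head_no_bar l (by rwa [List.head?_append_of_ne_nil _ hα])

/-- The part `φ(T₁)` of the decomposition of a parking quasi-ribbon. -/
theorem IsParkingQuasiRibbon.exists_shift_eq {ρ δ : SegWord}
    (h : IsParkingQuasiRibbon (ρ ++ δ)) (hδ : δ ≠ [])
    (hlt : ∀ (i : ℕ) (hi : i < δ.length), (δ[i]).1 ≤ i + maxLetter ρ) :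
    ∃ μ, IsParkingQuasiRibbon μ ∧ shift μ (maxLetter ρ - 1) = δ := by
  have h1 := one_le_maxLetter ρ
  have hpw := (List.pairwise_append.1 h.pairwise).2.2
  have hge : ∀ l ∈ δ, maxLetter ρ ≤ l.1 := fun l hl =>
    maxLetter_le (h.pos l (by simp [hl])) fun m hm => (hpw m hm l hl).1
  set k := maxLetter ρ - 1 with hk
  set μ : SegWord := δ.map fun l => (l.1 - k, l.2) with hμ
  have hsh : shift μ k = δ := by
    rw [hμ, shift, List.map_map]
    conv_rhs => rw [← List.map_id δ]
    refine List.map_congr_left fun l hl => ?_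
    have := hge l hl
    ext <;> simp
    omega
  refine ⟨μ, ⟨by simpa [hμ] using hδ, ?_, ?_, ?_, ?_⟩, hsh⟩
  · intro l hl
    obtain ⟨m, hm, rfl⟩ := List.mem_map.1 hl
    have := hge m hm
    simp only
    omega
  · have hc := (List.isChain_append.1 h.chain).2.1
    rw [← hsh, shift, List.isChain_map] at hc
    exact hc.imp fun l l' hll => by simpa using hll
  · intro i hi
    have := hlt i (by simpa [hμ] using hi)
    simp only [hμ, List.getElem_map]
    omega
  · intro l hl
    rcases δ with _ | ⟨m, δ⟩
    · exact absurd rfl hδ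
    simp only [hμ, List.map_cons, List.head?_cons, Option.mem_def, Option.some.injEq] at hl
    subst hl
    -- A bar before the first letter of `δ` would make it larger than all letters of `ρ`, whereas
    -- `hlt` at `0` bounds it by `max ρ`.
    by_contra hb
    simp only [Bool.not_eq_false] at hb
    by_cases hρ : ρ = []
    · subst hρ
      have := h.head_no_bar m (by simp)
      simp [this] at hb
    · have hm := hlt 0 (by simp)
      simp only [List.getElem_cons_zero, zero_add] at hm
      have hlt' : ∀ p ∈ ρ, p.1 + 1 ≤ m.1 := fun p hp => by
        have := hpw p hp m (by simp)
        have := this.2 hb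
        omega
      obtain ⟨p, hp⟩ := List.exists_mem_of_ne_nil _ hρ
      have h2 := hlt' p hp
      have h3 := h.pos p (by simp [hp])
      have := maxLetter_le (α := ρ) (k := m.1 - 1) (by omega) fun p hp => by
        have := hlt' p hp; omega
      omega

/-- The last position where `i - max` takes a given value cuts a parking quasi-ribbon. -/
theorem IsParkingQuasiRibbon.exists_cut {α : SegWord} {m : ℕ} {s : Bool}
    (h : IsParkingQuasiRibbon (α ++ [(m, s)])) :
    ∃ ρ δ, α = ρ ++ δ ∧ m = δ.length + maxLetter ρ ∧
      ∀ (i : ℕ) (hi : i < δ.length), (δ[i]).1 ≤ i + maxLetter ρ := by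
  have hm : m ≤ α.length + 1 := by
    have := h.parking α.length (by simp)
    simpa using this
  have hpos : 1 ≤ m := h.pos (m, s) (by simp)
  have hmax : maxLetter α ≤ m := maxLetter_le hpos fun l hl =>
    ((List.pairwise_append.1 h.pairwise).2.2 l hl (m, s) (by simp)).1
  -- The cut `p = |ρ|` must turn this inequality into an equality. It holds at `0` by the parking
  -- condition on `m`, and the greatest solution is chosen.
  set P : ℕ → Prop := fun p => p + m ≤ α.length + maxLetter (α.take p) with hP
  classical
  have hP0 : P 0 := by simp [hP, maxLetter]; omega
  set p := Nat.findGreatest P α.length with hp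
  have hpP : P p := Nat.findGreatest_spec (Nat.zero_le _) hP0
  have hple : p ≤ α.length := Nat.findGreatest_le _
  have hgt : ∀ q, p < q → q ≤ α.length → α.length + maxLetter (α.take q) < q + m := by
    intro q hq hq'
    have := Nat.findGreatest_is_greatest hq hq'
    simpa [hP] using this
  -- Equality holds at the greatest `p`: if `p = |α|` by monotonicity (`max α ≤ m`), otherwise
  -- because failure at `p + 1` gives the reverse inequality at `p`.
  have hlen : (α.drop p).length = α.length - p := by simp
  have hM : m = (α.drop p).length + maxLetter (α.take p) := by
    rw [hlen]
    rcases hple.eq_or_lt with he | hlt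
    · have : P p := hpP
      simp only [hP, he, List.take_length] at this ⊢
      omega
    · have h1 := hgt (p + 1) (by omega) hlt
      have h2 : maxLetter (α.take p) ≤ maxLetter (α.take (p + 1)) := by
        rw [List.take_add, maxLetter_append]
        exact le_max_left _ _
      simp only [hP] at hpP
      omega
  refine ⟨α.take p, α.drop p, (List.take_append_drop p α).symm, hM, fun i hi => ?_⟩
  -- Failure of the inequality at every later position is exactly the parking bound on `δ`.
  have h1 := hgt (p + i + 1) (by omega) (by omega)
  have h2 : ((α.drop p)[i]).1 ≤ maxLetter (α.take (p + i + 1)) := by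
    refine le_maxLetter ?_
    rw [List.getElem_drop]
    exact List.mem_take_iff_getElem.2 ⟨p + i, by omega, rfl⟩
  omega

theorem IsParkingQuasiRibbon.exists_phi_eq {α : SegWord} (h : IsParkingQuasiRibbon α) :
    ∃ b : ColoredBinaryTree, b.WellColored ∧ b.phi = α := by
  induction hn : α.length using Nat.strong_induction_on generalizing α with
  | _ n ih =>
    obtain ⟨α, ⟨m, s⟩, rfl⟩ : ∃ α' l, α = α' ++ [l] :=
      ⟨_, _, (List.dropLast_append_getLast h.ne_nil).symm⟩
    obtain ⟨ρ, δ, rfl, hm, hlt⟩ := h.exists_cut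
    simp only [List.length_append, List.length_singleton] at hn
    obtain ⟨r, hr, hrρ⟩ : ∃ r : ColoredBinaryTree, r.WellColored ∧ r.phi = ρ := by
      by_cases hρ : ρ = []
      · exact ⟨.empty, trivial, hρ.symm⟩
      · rw [List.append_assoc] at h
        exact ih _ (by omega) (h.of_append hρ) rfl
    by_cases hδ : δ = []
    · subst hδ
      refine ⟨.node s .empty r, ⟨fun hs => ?_, trivial, hr⟩, ?_⟩
      -- With `δ` empty, `m = max ρ`, so a bar before `m` would separate equal letters, or begin the
      -- word.
      · exfalso
        subst hs
        simp only [List.length_nil, zero_add] at hm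
        by_cases hρ : ρ = []
        · subst hρ
          have := h.head_no_bar (m, true) (by simp)
          simp at this
        · have hlt' : ∀ p ∈ ρ, p.1 + 1 ≤ m := fun p hp => by
            have := (List.pairwise_append.1 h.pairwise).2.2 p (by simp [hp]) (m, true) (by simp)
            have := this.2 rfl
            simp only at *
            omega
          obtain ⟨p, hp⟩ := List.exists_mem_of_ne_nil _ hρ
          have h2 := hlt' p hp
          have h3 := h.pos p (by simp [hp])
          -- The bound `1 ≤ m - 1`, needed because of the default maximum `1`, comes from the letter
          -- `p ≥ 1` of `ρ`.
          have := maxLetter_le (α := ρ) (k := m - 1) (by omega) fun p hp => by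
            have := hlt' p hp; omega
          omega
      · simp [phi, hrρ, shift, size, hm]
    · obtain ⟨μ, hμ, rfl⟩ := (h.of_append (by simp [hδ])).exists_shift_eq hδ hlt
      simp only [length_shift] at hn hm
      obtain ⟨l, hl, rfl⟩ := ih _ (by omega) hμ rfl
      refine ⟨.node s l r, ⟨fun _ hle => hδ (by simp [hle, phi, shift]), hl, hr⟩, ?_⟩
      rw [phi, hrρ, hm, length_phi]

/-! ### The bijection from pseudocompositions to parking quasi-ribbons -/

/-- The map `φ` on pseudocompositions, as the morphism sending `x` to `1`. -/
noncomputable def Pseudocomposition.phi : Pseudocomposition → ParkingQuasiRibbon :=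
  lift ParkingQuasiRibbon.prec ParkingQuasiRibbon.circ ParkingQuasiRibbon.succ
    ParkingQuasiRibbon.one

theorem Pseudocomposition.val_phi (I : Pseudocomposition) : I.phi.1 = I.toBinary.phi :=
  I.toBinary_wellColored.eval_eq_phi I.toBinary_ne_empty

theorem Pseudocomposition.phi_bijective : Function.Bijective Pseudocomposition.phi := by
  refine ⟨fun I J h => ?_, fun α => ?_⟩
  · refine toBinary_injective (I.toBinary_wellColored.eq_of_phi_eq J.toBinary_wellColored ?_)
    rw [← val_phi, h, val_phi]
  · obtain ⟨b, hb, hα⟩ := α.2.exists_phi_eq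
    have hne : b ≠ .empty := by
      rintro rfl
      exact α.2.ne_nil hα.symm
    obtain ⟨I, rfl⟩ := exists_toBinary_eq hb hne
    exact ⟨I, Subtype.ext (I.val_phi.trans hα)⟩

/-- No computation with codes is needed: `φ` is an injective morphism into a set where the relations
hold, and being a morphism required the relations in the target only. -/
theorem Pseudocomposition.relations : TriduplicialRelations Pseudocomposition.prec
    Pseudocomposition.circ Pseudocomposition.succ := by
  have h := ParkingQuasiRibbon.relations
  have hp : ∀ I J : Pseudocomposition, (I.prec J).phi = I.phi.prec J.phi := lift_prec _ h
  have hc : ∀ I J : Pseudocomposition, (I.circ J).phi = I.phi.circ J.phi := lift_circ _ h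
  have hs : ∀ I J : Pseudocomposition, (I.succ J).phi = I.phi.succ J.phi := lift_succ _ h
  constructor <;> intro x y z <;> apply phi_bijective.1 <;>
    simp only [hp, hc, hs, h.prec_prec, h.circ_circ, h.succ_succ, h.succ_prec, h.circ_prec,
      h.succ_circ, h.circ_succ]

/-! ### Bilinear extension -/

section Bilinear

variable {K : Type v} [CommRing K] {X : Type u}

/-- The bilinear extension of a binary operation to the free module. -/
noncomputable def bilinearExtension (K : Type v) [CommRing K] {X : Type u} (op : X → X → X) :
    (X →₀ K) →ₗ[K] (X →₀ K) →ₗ[K] (X →₀ K) :=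
  Finsupp.linearCombination K fun I =>
    Finsupp.linearCombination K fun J => Finsupp.single (op I J) (1 : K)

theorem bilinearExtension_single (op : X → X → X) (I J : X) :
    bilinearExtension K op (Finsupp.single I 1) (Finsupp.single J 1) =
      Finsupp.single (op I J) 1 := by
  simp [bilinearExtension]

theorem bilinearExtension_assoc (op₁ op₂ op₃ op₄ : X → X → X)
    (h : ∀ x y z, op₁ (op₂ x y) z = op₃ x (op₄ y z)) (x y z : X →₀ K) :
    bilinearExtension K op₁ (bilinearExtension K op₂ x y) z =
      bilinearExtension K op₃ x (bilinearExtension K op₄ y z) := by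
  have hs : ∀ (I : X) (c : K), Finsupp.single I c = c • Finsupp.single I 1 := by simp
  induction x using Finsupp.induction_linear with
  | zero => simp
  | add x x' hx hx' => simp [hx, hx']
  | single I c =>
    induction y using Finsupp.induction_linear with
    | zero => simp
    | add y y' hy hy' => simp [hy, hy']
    | single J d =>
      induction z using Finsupp.induction_linear with
      | zero => simp
      | add z z' hz hz' => simp [hz, hz']
      | single L e =>
        rw [hs I, hs J, hs L]
        simp only [map_smul, LinearMap.smul_apply, bilinearExtension_single, h]

theorem bilinearExtension_map {B : Type w} [AddCommGroup B] [Module K B] (op : X → X → X)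
    (β : B →ₗ[K] B →ₗ[K] B) (f : (X →₀ K) →ₗ[K] B)
    (h : ∀ I J, f (Finsupp.single (op I J) 1) = β (f (Finsupp.single I 1)) (f (Finsupp.single J 1)))
    (x y : X →₀ K) : f (bilinearExtension K op x y) = β (f x) (f y) := by
  have hs : ∀ (I : X) (c : K), Finsupp.single I c = c • Finsupp.single I 1 := by simp
  induction x using Finsupp.induction_linear with
  | zero => simp
  | add x x' hx hx' => simp [hx, hx']
  | single I c =>
    induction y using Finsupp.induction_linear with
    | zero => simp
    | add y y' hy hy' => simp [hy, hy']
    | single J d =>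
      rw [hs I, hs J]
      simp only [map_smul, LinearMap.smul_apply, bilinearExtension_single, h]

/-- The triduplicial algebra of a set with three operations satisfying the triduplicial
relations. -/
noncomputable def TriduplicialRelations.algebra (K : Type v) [CommRing K]
    {prec circ succ : X → X → X} (h : TriduplicialRelations prec circ succ) :
    TriduplicialAlgebra K (X →₀ K) where
  prec := bilinearExtension K prec
  circ := bilinearExtension K circ
  succ := bilinearExtension K succ
  relations :=
    { prec_prec := bilinearExtension_assoc _ _ _ _ h.prec_prec
      circ_circ := bilinearExtension_assoc _ _ _ _ h.circ_circ
      succ_succ := bilinearExtension_assoc _ _ _ _ h.succ_succ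
      succ_prec := bilinearExtension_assoc _ _ _ _ h.succ_prec
      circ_prec := bilinearExtension_assoc _ _ _ _ h.circ_prec
      succ_circ := bilinearExtension_assoc _ _ _ _ h.succ_circ
      circ_succ := bilinearExtension_assoc _ _ _ _ h.circ_succ }

end Bilinear

end Schroder

/-! ### The bijection and the two forms of freeness -/

theorem mainTheorem3 :
    -- the operations are transported from parking quasi-ribbons through the bijection `φ`
    (∃ Φ : Pseudocomposition ≃ ParkingQuasiRibbon,
      (∀ (n : ℕ) (c : Fin (n + 2) → SchroderTree),
        (Φ (Pseudocomposition.ofNode n c)).1 = (SchroderTree.node n c).phi) ∧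
      (∀ I J, Φ (I.prec J) = (Φ I).prec (Φ J)) ∧
      (∀ I J, Φ (I.circ J) = (Φ I).circ (Φ J)) ∧
      (∀ I J, Φ (I.succ J) = (Φ I).succ (Φ J)) ∧
      (Φ Pseudocomposition.x).1 = [(1, false)]) ∧
    -- the seven triduplicial relations
    TriduplicialRelations Pseudocomposition.prec Pseudocomposition.circ Pseudocomposition.succ ∧
    -- freeness, for sets with three operations satisfying the triduplicial relations
    (∀ (S : Type u) (prec circ succ : S → S → S), TriduplicialRelations prec circ succ →
      ∀ a : S, ∃! f : Pseudocomposition → S,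
        f Pseudocomposition.x = a ∧
        (∀ I J, f (I.prec J) = prec (f I) (f J)) ∧
        (∀ I J, f (I.circ J) = circ (f I) (f J)) ∧
        (∀ I J, f (I.succ J) = succ (f I) (f J))) ∧
    -- freeness, for triduplicial algebras: the free module on the set of Schröder
    -- pseudocompositions, with the operations extended bilinearly
    (∀ (K : Type v) [CommRing K],
      ∃ 𝒜 : TriduplicialAlgebra K (Pseudocomposition →₀ K),
        (∀ I J : Pseudocomposition, 𝒜.prec (Finsupp.single I 1) (Finsupp.single J 1) =
          Finsupp.single (I.prec J) 1) ∧
        (∀ I J : Pseudocomposition, 𝒜.circ (Finsupp.single I 1) (Finsupp.single J 1) =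
          Finsupp.single (I.circ J) 1) ∧
        (∀ I J : Pseudocomposition, 𝒜.succ (Finsupp.single I 1) (Finsupp.single J 1) =
          Finsupp.single (I.succ J) 1) ∧
        ∀ (B : Type w) [AddCommGroup B] [Module K B] (ℬ : TriduplicialAlgebra K B) (b : B),
          ∃! f : (Pseudocomposition →₀ K) →ₗ[K] B,
            𝒜.IsHom ℬ f ∧ f (Finsupp.single Pseudocomposition.x 1) = b) := by
  have hR := ParkingQuasiRibbon.relations
  refine ⟨⟨Equiv.ofBijective _ Pseudocomposition.phi_bijective, fun n c => ?_,
    Pseudocomposition.lift_prec _ hR, Pseudocomposition.lift_circ _ hR,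
    Pseudocomposition.lift_succ _ hR, congrArg Subtype.val (Pseudocomposition.lift_x _)⟩,
    Pseudocomposition.relations, fun S prec circ succ h a => ?_, fun K _ => ?_⟩
  · rw [Equiv.ofBijective_apply, Pseudocomposition.val_phi, Pseudocomposition.toBinary_ofNode]
    rfl
  · refine ⟨Pseudocomposition.lift prec circ succ a, ⟨Pseudocomposition.lift_x a,
      Pseudocomposition.lift_prec a h, Pseudocomposition.lift_circ a h,
      Pseudocomposition.lift_succ a h⟩, ?_⟩
    rintro g ⟨gx, gp, gc, gs⟩
    refine funext (Pseudocomposition.generated ?_ ?_ ?_ ?_)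
    · rw [gx, Pseudocomposition.lift_x]
    · intro I J hI hJ
      rw [gp, hI, hJ, Pseudocomposition.lift_prec a h]
    · intro I J hI hJ
      rw [gc, hI, hJ, Pseudocomposition.lift_circ a h]
    · intro I J hI hJ
      rw [gs, hI, hJ, Pseudocomposition.lift_succ a h]
  · refine ⟨Pseudocomposition.relations.algebra K, bilinearExtension_single _,
      bilinearExtension_single _, bilinearExtension_single _, fun B _ _ ℬ b => ?_⟩
    have h := ℬ.relations
    set F : Pseudocomposition → B := Pseudocomposition.lift (fun x y => ℬ.prec x y)
      (fun x y => ℬ.circ x y) (fun x y => ℬ.succ x y) b with hF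
    refine ⟨Finsupp.linearCombination K F,
      ⟨⟨bilinearExtension_map _ _ _ fun I J => ?_, bilinearExtension_map _ _ _ fun I J => ?_,
        bilinearExtension_map _ _ _ fun I J => ?_⟩, ?_⟩, ?_⟩
    · simpa using Pseudocomposition.lift_prec b h I J
    · simpa using Pseudocomposition.lift_circ b h I J
    · simpa using Pseudocomposition.lift_succ b h I J
    · simpa using Pseudocomposition.lift_x b
    · rintro g ⟨⟨gp, gc, gs⟩, gx⟩
      -- A linear map is determined on the basis, where agreement propagates from `x` by generation.
      have hg : ∀ I, g (Finsupp.single I 1) = F I := by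
        refine Pseudocomposition.generated ?_ ?_ ?_ ?_
        · rw [gx, hF, Pseudocomposition.lift_x]
        · intro I J hI hJ
          rw [hF, Pseudocomposition.lift_prec b h, ← hF, ← hI, ← hJ, ← gp]
          exact congrArg g (bilinearExtension_single _ I J).symm
        · intro I J hI hJ
          rw [hF, Pseudocomposition.lift_circ b h, ← hF, ← hI, ← hJ, ← gc]
          exact congrArg g (bilinearExtension_single _ I J).symm
        · intro I J hI hJ
          rw [hF, Pseudocomposition.lift_succ b h, ← hF, ← hI, ← hJ, ← gs]
          exact congrArg g (bilinearExtension_single _ I J).symm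
      refine Finsupp.lhom_ext' fun I => LinearMap.ext_ring ?_
      simpa using hg I
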